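/- Let $m,N\ge 0$ be integers, $M=2^m$, and let $n_{i,k}\in\{0,1\}$ ($0\le k<m$) be the $k$-th binary digit of $i\in\{0,\dots,M-1\}$, $k=0$ being the least significant one; write $\bar u=1-u$. A constellation $[\mathbb X,\mathbb P]$ consists of an alphabet $\mathbb X=(\boldsymbol x_0,\dots,\boldsymbol x_{M-1})$ of vectors in $\mathbb R^N$ and a distribution of the form $P_i=\prod_{k=0}^{m-1}P_{C_k}(n_{i,k})$, where the independent bits $C_0,\dots,C_{m-1}$ satisfy $0<P_{C_k}(0)<1$ and $P_{C_k}(1)=1-P_{C_k}(0)$; the symbol $\boldsymbol X=\boldsymbol x_i$ is sent when $C_k=n_{i,k}$ for all $k$. The uniform distribution $\mathbb U_m$ is the case $P_{C_k}(0)=\tfrac12$ for all $k$. The channel is $\boldsymbol Y=\boldsymbol H\circ\boldsymbol X+\boldsymbol Z$, where $\circ$ is the element-wise product, $\boldsymbol Z$ is Gaussian with independent components of mean $0$ and variance $N_0/2$, $N_0>0$, and $\boldsymbol H$ is a random vector in $\mathbb R^N$ with (possibly dependent) identically distributed components, $0<\mathbb E[H^2]<\infty$; $\boldsymbol X,\boldsymbol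 H,\boldsymbol Z$ are independent. Let $I=\sum_{k=0}^{m-1}I(C_k;\boldsymbol Y|\boldsymbol H)$, in bits, with $I(C_k;\boldsymbol Y|\boldsymbol H)=\mathbb E\big[\log_2\frac{p(\boldsymbol Y|\boldsymbol H,C_k)}{p(\boldsymbol Y|\boldsymbol H)}\big]$, be the BICM generalized mutual information, regarded as a function $I(\mathrm{SNR})$ of $\mathrm{SNR}=\mathbb E[H^2]\,E_{\mathrm s}/N_0\ge 0$ by rescaling the alphabet for fixed $N_0$, fixed law of $\boldsymbol H$ and fixed $\mathbb P$. The low-GMI parameters of $[\mathbb X,\mathbb P]$ are $[\boldsymbol\mu,E_{\mathrm s},\alpha]$ with $$\boldsymbol\mu=\mathbb E[\boldsymbol X],\qquad E_{\mathrm s}=\mathbb E[\|\boldsymbol X\|^2],\qquad \alpha=\frac{d\,I(\mathrm{SNR})}{d\,\mathrm{SNR}}\Big|_{\mathrm{SNR}=0^+}$$ (if all $\boldsymbol x_i=\boldsymbol 0$, then $I(\mathrm{SNR})$ is read as $0$, so $\alpha=0$). The transform $\mathring{\mathbb X}$ of $\mathbb X$ is $$\mathring{\boldsymbol x}_i=\sum_{j=0}^{M-1}\gamma_{i,j}\sqrt{P_j}\,\boldsymbol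 x_j,\qquad \gamma_{i,j}=\prod_{k=0}^{m-1}\Big[(-1)^{\bar n_{i,k}n_{j,k}}\sqrt{P_{C_k}(0)}+(-1)^{n_{i,k}\bar n_{j,k}}\sqrt{P_{C_k}(1)}\Big].$$ Theorem. For every constellation $[\mathbb X,\mathbb P]$ as above, the derivatives defining $\alpha$ exist for $[\mathbb X,\mathbb P]$ and for $[\mathring{\mathbb X},\mathbb U_m]$, and the low-GMI parameters $[\boldsymbol\mu,E_{\mathrm s},\alpha]$ of $[\mathbb X,\mathbb P]$ are equal to those of $[\mathring{\mathbb X},\mathbb U_m]$ (for the same law of $\boldsymbol H$). -/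

import Mathlib

open MeasureTheory

namespace BICM

/-- The bit `n_{i,k}` of the natural binary code: binary digit number `k` of `i`, where digit `0` is
the least significant one. -/
def nbcBit {m : ℕ} (i : Fin (2 ^ m)) (k : Fin m) : Bool :=
  (i : ℕ).testBit (k : ℕ)

/-- The probability `P_{C_k}(u)` of bit number `k` being `u`, where `b k = P_{C_k}(0)`. -/
def bitProb {m : ℕ} (b : Fin m → ℝ) (k : Fin m) (u : Bool) : ℝ :=
  if u then 1 - b k else b k

/-- The product-form probability `P_i` of symbol number `i`, for the bit probabilities `b`. -/
def symbolProb {m : ℕ} (b : Fin m → ℝ) (i : Fin (2 ^ m)) : ℝ :=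
  ∏ k : Fin m, bitProb b k (nbcBit i k)

/-- Bit probabilities of the uniform distribution `U_m`. -/
noncomputable def uniformBits (m : ℕ) : Fin m → ℝ :=
  fun _ => 1 / 2

theorem symbolProb_uniformBits {m : ℕ} (i : Fin (2 ^ m)) :
    symbolProb (uniformBits m) i = 1 / (2 : ℝ) ^ m := by
  have h : ∀ k : Fin m, bitProb (uniformBits m) k (nbcBit i k) = 1 / 2 := by
    intro k
    unfold bitProb uniformBits
    split <;> norm_num
  simp [symbolProb, h]

/-- The coefficients `γ_{i,j}` of the transform. -/
noncomputable def gammaCoeff {m : ℕ} (b : Fin m → ℝ) (i j : Fin (2 ^ m)) : ℝ :=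
  ∏ k : Fin m,
    ((-1) ^ ((!nbcBit i k).toNat * (nbcBit j k).toNat) * √(bitProb b k false) +
      (-1) ^ ((nbcBit i k).toNat * (!nbcBit j k).toNat) * √(bitProb b k true))

/-- The transform of the alphabet `X` for the bit probabilities `b`. -/
noncomputable def newTransform {m N : ℕ} (b : Fin m → ℝ)
    (X : Fin (2 ^ m) → EuclideanSpace ℝ (Fin N)) : Fin (2 ^ m) → EuclideanSpace ℝ (Fin N) :=
  fun i => ∑ j, (gammaCoeff b i j * √(symbolProb b j)) • X j

/-- The mean `E[X]` of the channel input. -/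
noncomputable def mean {m N : ℕ} (b : Fin m → ℝ)
    (X : Fin (2 ^ m) → EuclideanSpace ℝ (Fin N)) : EuclideanSpace ℝ (Fin N) :=
  ∑ i, symbolProb b i • X i

/-- The average symbol energy `E[‖X‖²]` of the channel input. -/
noncomputable def energy {m N : ℕ} (b : Fin m → ℝ)
    (X : Fin (2 ^ m) → EuclideanSpace ℝ (Fin N)) : ℝ :=
  ∑ i, symbolProb b i * ‖X i‖ ^ 2

/-- The element-wise product of two vectors. -/
noncomputable def hadamardProd {N : ℕ} (h x : EuclideanSpace ℝ (Fin N)) :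
    EuclideanSpace ℝ (Fin N) :=
  WithLp.toLp 2 (fun n => h n * x n)

/-- The density `p(y | x, h)` of `Y = h ∘ x + Z`, where `Z` is Gaussian with independent
components of mean zero and variance `N₀ / 2`. -/
noncomputable def channelDensity {N : ℕ} (N₀ : ℝ) (h x y : EuclideanSpace ℝ (Fin N)) : ℝ :=
  1 / (N₀ * Real.pi) ^ ((N : ℝ) / 2) * Real.exp (-(‖y - hadamardProd h x‖ ^ 2 / N₀))

/-- The density `p(y | h)` of the channel output given the fading vector `h`. -/
noncomputable def outputDensity {m N : ℕ} (N₀ : ℝ) (b : Fin m → ℝ)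
    (X : Fin (2 ^ m) → EuclideanSpace ℝ (Fin N)) (h y : EuclideanSpace ℝ (Fin N)) : ℝ :=
  ∑ i, symbolProb b i * channelDensity N₀ h (X i) y

/-- The conditional probability of symbol number `i` given that bit number `k` is `u`. -/
noncomputable def condSymbolProb {m : ℕ} (b : Fin m → ℝ) (k : Fin m) (u : Bool)
    (i : Fin (2 ^ m)) : ℝ :=
  if nbcBit i k = u then symbolProb b i / bitProb b k u else 0

/-- The density `p(y | h, C_k = u)` of the channel output given the fading vector `h` and the
value `u` of bit number `k`. -/
noncomputable def condOutputDensity {m N : ℕ} (N₀ : ℝ) (b : Fin m → ℝ)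
    (X : Fin (2 ^ m) → EuclideanSpace ℝ (Fin N)) (k : Fin m) (u : Bool)
    (h y : EuclideanSpace ℝ (Fin N)) : ℝ :=
  ∑ i, condSymbolProb b k u i * channelDensity N₀ h (X i) y

/-- The mutual information `I(C_k; Y | H)` in bits, the expectation of
`log₂ (p(Y | H, C_k) / p(Y | H))`, where `ν` is the law of the fading vector `H`. -/
noncomputable def bitMutualInfo {m N : ℕ} (ν : Measure (EuclideanSpace ℝ (Fin N))) (N₀ : ℝ)
    (b : Fin m → ℝ) (X : Fin (2 ^ m) → EuclideanSpace ℝ (Fin N)) (k : Fin m) : ℝ :=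
  ∫ h, (∑ u : Bool, bitProb b k u *
    (∫ y, condOutputDensity N₀ b X k u h y *
      Real.logb 2 (condOutputDensity N₀ b X k u h y / outputDensity N₀ b X h y) ∂volume)) ∂ν

/-- The BICM generalized mutual information `∑ₖ I(C_k; Y | H)`. -/
noncomputable def gmi {m N : ℕ} (ν : Measure (EuclideanSpace ℝ (Fin N))) (N₀ : ℝ)
    (b : Fin m → ℝ) (X : Fin (2 ^ m) → EuclideanSpace ℝ (Fin N)) : ℝ :=
  ∑ k, bitMutualInfo ν N₀ b X k

/-- The second moment `E[H²]` of a fading coefficient with law `ρ`. -/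
noncomputable def secondMoment (ρ : Measure ℝ) : ℝ :=
  ∫ t, t ^ 2 ∂ρ

/-- The signal-to-noise ratio `E[H²] E_s / N₀`. -/
noncomputable def snr {m N : ℕ} (ρ : Measure ℝ) (N₀ : ℝ) (b : Fin m → ℝ)
    (X : Fin (2 ^ m) → EuclideanSpace ℝ (Fin N)) : ℝ :=
  secondMoment ρ * energy b X / N₀

/-- The BICM-GMI as a function of the signal-to-noise ratio `s ≥ 0`: the noise level `N₀` and the
bit probabilities are fixed, and the alphabet is rescaled so that the signal-to-noise ratio
becomes `s`. -/
noncomputable def gmiAtSNR {m N : ℕ} (ν : Measure (EuclideanSpace ℝ (Fin N))) (ρ : Measure ℝ)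
    (N₀ : ℝ) (b : Fin m → ℝ) (X : Fin (2 ^ m) → EuclideanSpace ℝ (Fin N)) (s : ℝ) : ℝ :=
  gmi ν N₀ b (fun i => √(s / snr ρ N₀ b X) • X i)

/-- The rescaled alphabet has signal-to-noise ratio `s`. -/
theorem snr_rescale {m N : ℕ} (ρ : Measure ℝ) (N₀ : ℝ) (b : Fin m → ℝ)
    (X : Fin (2 ^ m) → EuclideanSpace ℝ (Fin N)) (hX : 0 < snr ρ N₀ b X) {s : ℝ} (hs : 0 ≤ s) :
    snr ρ N₀ b (fun i => √(s / snr ρ N₀ b X) • X i) = s := by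
  have hE : energy b (fun i => √(s / snr ρ N₀ b X) • X i) = s / snr ρ N₀ b X * energy b X := by
    unfold energy
    rw [Finset.mul_sum]
    refine Finset.sum_congr rfl fun i _ => ?_
    rw [norm_smul, mul_pow, Real.norm_eq_abs, sq_abs, Real.sq_sqrt (div_nonneg hs hX.le)]
    ring
  calc snr ρ N₀ b (fun i => √(s / snr ρ N₀ b X) • X i)
      = s / snr ρ N₀ b X * snr ρ N₀ b X := by
        rw [snr, hE, snr]; ring
    _ = s := div_mul_cancel₀ s hX.ne'

/-- The slope of the BICM-GMI at zero signal-to-noise ratio (a one-sided derivative, as the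
signal-to-noise ratio is nonnegative). -/
noncomputable def alpha {m N : ℕ} (ν : Measure (EuclideanSpace ℝ (Fin N))) (ρ : Measure ℝ)
    (N₀ : ℝ) (b : Fin m → ℝ) (X : Fin (2 ^ m) → EuclideanSpace ℝ (Fin N)) : ℝ :=
  derivWithin (gmiAtSNR ν ρ N₀ b X) (Set.Ici 0) 0

/-- The low-GMI parameters `[μ, E_s, α]` of the constellation with alphabet `X` and bit
probabilities `b`. -/
noncomputable def lowGMIParameters {m N : ℕ} (ν : Measure (EuclideanSpace ℝ (Fin N)))
    (ρ : Measure ℝ) (N₀ : ℝ) (b : Fin m → ℝ) (X : Fin (2 ^ m) → EuclideanSpace ℝ (Fin N)) :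
    EuclideanSpace ℝ (Fin N) × ℝ × ℝ :=
  (mean b X, energy b X, alpha ν ρ N₀ b X)

end BICM

/-! Write `D(b)` for the Kullback–Leibler divergence of the channel output from the pure noise
when the bit probabilities are `b`. By the compensation identity, `I(C_k; Y | H)` is the average
of `D` over the two values of bit `k` minus `D(b)`. When the alphabet is scaled by `ε`, `D(b)`
behaves like `ε² E[H²] ‖E[X]‖² / N₀` for every `b`, so that `α` is `∑ₖ ‖cₖ‖² / (E_s log 2)`, where
`cₖ` is the difference of the two conditional means given bit `k`, scaled by the standard
deviation of the bit.

The mean is multiaffine in `b`, and symbol `i` of the transform is its value at the point whose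
coordinate `k` is `P(C_k = 0)` displaced by plus or minus one standard deviation of bit `k`,
according to the label of `i`. Under uniform bits these signs average to `0`, which preserves the
mean, and fixing one of them moves the mean by exactly `± cₖ`. The energy is preserved because the
signs are orthonormal, which makes the displaced symbol probabilities of distinct symbols
orthogonal and those of symbol `j` of squared norm `P_j`.
-/

namespace BICM

open Filter Topology InformationTheory

section KullbackLeibler

theorem klFun_exp_le (t : ℝ) : klFun (Real.exp t) ≤ t ^ 2 * Real.exp |t| := by
  have hexp : |Real.exp t - 1| ≤ |t| * Real.exp |t| := by
    have h := Complex.norm_exp_sub_sum_le_norm_mul_exp (t : ℂ) 1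
    simp only [Finset.sum_range_one, pow_zero, Nat.factorial_zero, Nat.cast_one, div_one, pow_one,
      Complex.norm_real, Real.norm_eq_abs] at h
    exact_mod_cast h
  calc klFun (Real.exp t) = t * (Real.exp t - 1) - (Real.exp t - 1 - t) := by
        rw [klFun_apply, Real.log_exp]; ring
    _ ≤ t * (Real.exp t - 1) := by linarith [Real.add_one_le_exp t]
    _ ≤ |t| * |Real.exp t - 1| := by rw [← abs_mul]; exact le_abs_self _
    _ ≤ |t| * (|t| * Real.exp |t|) := by gcongr
    _ = t ^ 2 * Real.exp |t| := by rw [← mul_assoc, ← sq, sq_abs]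

theorem klFun_exp_le_sq_mul_exp {ε t τ : ℝ} (hε : |ε| ≤ 1) (hτ : 0 ≤ τ) (ht : |t| ≤ |ε| * τ) :
    klFun (Real.exp t) ≤ ε ^ 2 * (2 * Real.exp (2 * τ)) := by
  have hτ_sq : τ ^ 2 ≤ 2 * Real.exp τ := by linarith [Real.quadratic_le_exp_of_nonneg hτ]
  calc klFun (Real.exp t) ≤ t ^ 2 * Real.exp |t| := klFun_exp_le t
    _ ≤ (|ε| * τ) ^ 2 * Real.exp τ := by
      rw [← sq_abs t]
      gcongr
      exact ht.trans (mul_le_of_le_one_left hτ hε)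
    _ ≤ ε ^ 2 * (2 * Real.exp τ) * Real.exp τ := by rw [mul_pow, sq_abs]; gcongr
    _ = ε ^ 2 * (2 * Real.exp (2 * τ)) := by rw [two_mul τ, Real.exp_add]; ring

theorem tendsto_klFun_div_sub_one_sq :
    Tendsto (fun x => klFun x / (x - 1) ^ 2) (𝓝[≠] 1) (𝓝 (1 / 2)) := by
  have hlog : Tendsto (fun x => Real.log x / (2 * (x - 1))) (𝓝[≠] 1) (𝓝 (1 / 2)) := by
    have h := ((hasDerivAt_iff_tendsto_slope.1 (Real.hasDerivAt_log one_ne_zero)).div_const 2)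
    simp only [slope_fun_def_field, Real.log_one, sub_zero, inv_one] at h
    exact h.congr fun x => by rw [div_div, mul_comm]
  have hne : ∀ᶠ x : ℝ in 𝓝[≠] 1, x ≠ 0 :=
    (eventually_ne_nhds one_ne_zero).filter_mono nhdsWithin_le_nhds
  refine HasDerivAt.lhopital_zero_nhdsNE
    (hne.mono fun x hx => hasDerivAt_klFun hx)
    (Eventually.of_forall fun x => ?_) ?_ ?_ ?_ hlog
  · simpa using ((hasDerivAt_id x).sub_const 1).fun_pow 2
  · filter_upwards [self_mem_nhdsWithin] with x hx
    exact mul_ne_zero two_ne_zero (sub_ne_zero.2 hx)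
  · simpa [klFun_one] using (continuous_klFun.tendsto 1).mono_left nhdsWithin_le_nhds
  · have h : Continuous fun x : ℝ => (x - 1) ^ 2 := by fun_prop
    simpa using (h.tendsto 1).mono_left nhdsWithin_le_nhds

theorem tendsto_klFun_div_sq {r : ℝ → ℝ} {d : ℝ} (hr : HasDerivAt r d 0) (h0 : r 0 = 1) :
    Tendsto (fun ε => klFun (r ε) / ε ^ 2) (𝓝[≠] 0) (𝓝 (d ^ 2 / 2)) := by
  let κ : ℝ → ℝ := Function.update (fun x => klFun x / (x - 1) ^ 2) 1 (1 / 2)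
  have hκ : ContinuousAt κ 1 := continuousAt_update_same.2 tendsto_klFun_div_sub_one_sq
  have hklFun : ∀ x, klFun x = κ x * (x - 1) ^ 2 := by
    intro x
    rcases eq_or_ne x 1 with rfl | hx
    · simp [klFun_one]
    · have : x - 1 ≠ 0 := sub_ne_zero.2 hx
      simp only [κ, Function.update_of_ne hx]
      field_simp
  have hslope : Tendsto (fun ε => (r ε - 1) / ε) (𝓝[≠] 0) (𝓝 d) := by
    simpa only [slope_fun_def_field, h0, sub_zero] using hasDerivAt_iff_tendsto_slope.1 hr
  have hκr : Tendsto (fun ε => κ (r ε)) (𝓝[≠] 0) (𝓝 (1 / 2)) := by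
    have h := (hκ.tendsto.comp (h0 ▸ hr.continuousAt.tendsto)).mono_left
      (nhdsWithin_le_nhds (s := {0}ᶜ))
    simpa [κ, Function.comp_def] using h
  convert hκr.mul (hslope.pow 2) using 2 with ε
  · rw [hklFun, div_pow, mul_div_assoc]
  · ring

/-- The integrand of the Kullback–Leibler divergence between densities with values `p` and `q`.
For `q ≠ 0` it equals `p * log (p / q) + q - p`; the summand `q - p`, which integrates to zero,
makes it nonnegative. -/
noncomputable def klDensity (p q : ℝ) : ℝ :=
  q * klFun (p / q)

theorem klDensity_eq {q : ℝ} (hq : q ≠ 0) (p : ℝ) :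
    klDensity p q = p * Real.log (p / q) + q - p := by
  rw [klDensity, klFun_apply]
  field_simp

theorem klDensity_nonneg {p q : ℝ} (hp : 0 ≤ p) (hq : 0 ≤ q) : 0 ≤ klDensity p q :=
  mul_nonneg hq (klFun_nonneg (div_nonneg hp hq))

theorem measurable_klDensity {α : Type*} [MeasurableSpace α] {f g : α → ℝ} (hf : Measurable f)
    (hg : Measurable g) : Measurable fun x => klDensity (f x) (g x) :=
  hg.mul (measurable_klFun.comp (hf.div hg))

variable {ι : Type*} [Fintype ι]

theorem klDensity_sum_le {w p : ι → ℝ} (hw : w ∈ stdSimplex ℝ ι) (hp : ∀ i, 0 ≤ p i) {q : ℝ}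
    (hq : 0 ≤ q) : klDensity (∑ i, w i * p i) q ≤ ∑ i, w i * klDensity (p i) q := by
  have hconv := convexOn_klFun.map_sum_le (t := Finset.univ) (w := w) (p := fun i => p i / q)
    (fun i _ => hw.1 i) hw.2 fun i _ => div_nonneg (hp i) hq
  simp only [smul_eq_mul] at hconv
  calc klDensity (∑ i, w i * p i) q = q * klFun (∑ i, w i * (p i / q)) := by
        simp only [klDensity, Finset.sum_div, mul_div_assoc]
    _ ≤ q * ∑ i, w i * klFun (p i / q) := by gcongr
    _ = ∑ i, w i * klDensity (p i) q := by
        simp only [klDensity, Finset.mul_sum, mul_left_comm]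

theorem sum_mul_klDensity_sum {w p : ι → ℝ} (hw : ∑ i, w i = 1) {q : ℝ} (hq : q ≠ 0)
    (hM : ∑ i, w i * p i ≠ 0) :
    ∑ i, w i * klDensity (p i) (∑ j, w j * p j) + klDensity (∑ i, w i * p i) q =
      ∑ i, w i * klDensity (p i) q := by
  have hsplit : ∀ i, w i * klDensity (p i) q = w i * klDensity (p i) (∑ j, w j * p j) +
      (w i * p i * Real.log ((∑ j, w j * p j) / q) + w i * q - w i * ∑ j, w j * p j) := by
    intro i
    rw [klDensity_eq hq, klDensity_eq hM]
    rcases eq_or_ne (p i) 0 with hp | hp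
    · rw [hp]; ring
    · rw [Real.log_div hp hq, Real.log_div hp hM, Real.log_div hM hq]; ring
  rw [Finset.sum_congr rfl fun i _ => hsplit i, Finset.sum_add_distrib, Finset.sum_sub_distrib,
    Finset.sum_add_distrib, ← Finset.sum_mul, ← Finset.sum_mul, ← Finset.sum_mul, hw, one_mul,
    one_mul, klDensity_eq hq]

section Integrals

variable {α : Type*} [MeasurableSpace α] {μ : Measure α}

theorem integral_mul_log_div {f g : α → ℝ} (hg0 : ∀ x, g x ≠ 0) (hf : Integrable f μ)
    (hg : Integrable g μ) (hfg : ∫ x, f x ∂μ = ∫ x, g x ∂μ)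
    (hkl : Integrable (fun x => klDensity (f x) (g x)) μ) :
    ∫ x, f x * Real.log (f x / g x) ∂μ = ∫ x, klDensity (f x) (g x) ∂μ := by
  have hpt : ∀ x, f x * Real.log (f x / g x) = klDensity (f x) (g x) - (g x - f x) := fun x => by
    rw [klDensity_eq (hg0 x)]; ring
  have hgf : Integrable (fun x => g x - f x) μ := hg.sub hf
  simp only [hpt]
  rw [integral_sub hkl hgf, integral_sub hg hf, hfg, sub_self, sub_zero]

variable {w : ι → ℝ} {f : ι → α → ℝ} {g : α → ℝ}

theorem integrable_klDensity_sum (hw : w ∈ stdSimplex ℝ ι) (hf : ∀ i, Measurable (f i))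
    (hf0 : ∀ i x, 0 ≤ f i x) (hg : Measurable g) (hg0 : ∀ x, 0 ≤ g x)
    (hkl : ∀ i, Integrable (fun x => klDensity (f i x) (g x)) μ) :
    Integrable (fun x => klDensity (∑ i, w i * f i x) (g x)) μ := by
  have hM : Measurable fun x => ∑ i, w i * f i x :=
    Finset.measurable_sum _ fun i _ => (hf i).const_mul _
  refine (integrable_finsetSum Finset.univ fun i _ => (hkl i).const_mul (w i)).mono'
    (measurable_klDensity hM hg).aestronglyMeasurable (Eventually.of_forall fun x => ?_)
  have hM0 : 0 ≤ ∑ i, w i * f i x :=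
    Finset.sum_nonneg fun i _ => mul_nonneg (hw.1 i) (hf0 i x)
  rw [Real.norm_of_nonneg (klDensity_nonneg hM0 (hg0 x))]
  exact klDensity_sum_le hw (hf0 · x) (hg0 x)

theorem integrable_mul_klDensity_mixture (hw : w ∈ stdSimplex ℝ ι) (hf : ∀ i, Measurable (f i))
    (hf0 : ∀ i x, 0 ≤ f i x) (hM0 : ∀ x, 0 < ∑ i, w i * f i x) (hg0 : ∀ x, 0 < g x)
    (hkl : ∀ i, Integrable (fun x => klDensity (f i x) (g x)) μ) (i : ι) :
    Integrable (fun x => w i * klDensity (f i x) (∑ j, w j * f j x)) μ := by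
  have hM : Measurable fun x => ∑ j, w j * f j x :=
    Finset.measurable_sum _ fun j _ => (hf j).const_mul _
  have hterm : ∀ j x, 0 ≤ w j * klDensity (f j x) (∑ l, w l * f l x) := fun j x =>
    mul_nonneg (hw.1 j) (klDensity_nonneg (hf0 j x) (hM0 x).le)
  refine (integrable_finsetSum Finset.univ fun j _ => (hkl j).const_mul (w j)).mono'
    ((measurable_klDensity (hf i) hM).const_mul _).aestronglyMeasurable
    (Eventually.of_forall fun x => ?_)
  rw [Real.norm_of_nonneg (hterm i x), ← sum_mul_klDensity_sum hw.2 (hg0 x).ne' (hM0 x).ne']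
  exact (Finset.single_le_sum (fun j _ => hterm j x) (Finset.mem_univ i)).trans
    (le_add_of_nonneg_right (klDensity_nonneg (hM0 x).le (hg0 x).le))

theorem sum_mul_integral_klDensity_mixture (hw : w ∈ stdSimplex ℝ ι)
    (hf : ∀ i, Measurable (f i)) (hf0 : ∀ i x, 0 ≤ f i x) (hM0 : ∀ x, 0 < ∑ i, w i * f i x)
    (hg : Measurable g) (hg0 : ∀ x, 0 < g x)
    (hkl : ∀ i, Integrable (fun x => klDensity (f i x) (g x)) μ) :
    ∑ i, w i * ∫ x, klDensity (f i x) (∑ j, w j * f j x) ∂μ =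
      ∑ i, w i * ∫ x, klDensity (f i x) (g x) ∂μ - ∫ x, klDensity (∑ i, w i * f i x) (g x) ∂μ := by
  have hmix := integrable_mul_klDensity_mixture hw hf hf0 hM0 hg0 hkl
  have hsum := integrable_klDensity_sum hw hf hf0 hg (fun x => (hg0 x).le) hkl
  simp only [← integral_const_mul]
  rw [← integral_finsetSum _ fun i _ => hmix i,
    ← integral_finsetSum _ fun i _ => (hkl i).const_mul (w i), eq_sub_iff_add_eq,
    ← integral_add (integrable_finsetSum _ fun i _ => hmix i) hsum]
  exact integral_congr_ae (Eventually.of_forall fun x =>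
    sum_mul_klDensity_sum hw.2 (hg0 x).ne' (hM0 x).ne')

theorem sum_mul_integral_mul_log_div (hw : w ∈ stdSimplex ℝ ι)
    (hf : ∀ i, Measurable (f i)) (hf0 : ∀ i x, 0 ≤ f i x) (hfint : ∀ i, Integrable (f i) μ)
    (hf1 : ∀ i, ∫ x, f i x ∂μ = 1) (hM0 : ∀ x, 0 < ∑ i, w i * f i x)
    (hg : Measurable g) (hg0 : ∀ x, 0 < g x)
    (hkl : ∀ i, Integrable (fun x => klDensity (f i x) (g x)) μ) :
    ∑ i, w i * ∫ x, f i x * Real.log (f i x / ∑ j, w j * f j x) ∂μ =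
      ∑ i, w i * ∫ x, klDensity (f i x) (g x) ∂μ - ∫ x, klDensity (∑ i, w i * f i x) (g x) ∂μ := by
  have hMint : Integrable (fun x => ∑ i, w i * f i x) μ :=
    integrable_finsetSum _ fun i _ => (hfint i).const_mul (w i)
  have hM1 : ∫ x, ∑ i, w i * f i x ∂μ = 1 := by
    rw [integral_finsetSum _ fun i _ => (hfint i).const_mul (w i)]
    simp only [integral_const_mul, hf1, mul_one, hw.2]
  rw [← sum_mul_integral_klDensity_mixture hw hf hf0 hM0 hg hg0 hkl]
  refine Finset.sum_congr rfl fun i _ => ?_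
  rcases eq_or_ne (w i) 0 with hi | hi
  · rw [hi, zero_mul, zero_mul]
  · have hkli := integrable_mul_klDensity_mixture hw hf hf0 hM0 hg0 hkl i
    rw [integral_mul_log_div (fun x => (hM0 x).ne') (hfint i) hMint ((hf1 i).trans hM1.symm)
      ((integrable_const_mul_iff (isUnit_iff_ne_zero.2 hi) _).1 hkli)]

end Integrals

end KullbackLeibler

section Gaussian

variable {V : Type*} [NormedAddCommGroup V] [InnerProductSpace ℝ V]

/-- The density at `y` of the isotropic Gaussian distribution with mean `a` whose variance in each
direction is `s / 2`, the normalization in which the noise spectral density `N₀` is `s`. -/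
noncomputable def gaussDensity (s : ℝ) (a y : V) : ℝ :=
  1 / (s * Real.pi) ^ ((Module.finrank ℝ V : ℝ) / 2) * Real.exp (-(‖y - a‖ ^ 2 / s))

theorem gaussDensity_pos {s : ℝ} (hs : 0 < s) (a y : V) : 0 < gaussDensity s a y := by
  unfold gaussDensity
  positivity

theorem continuous_gaussDensity (s : ℝ) : Continuous fun z : V × V => gaussDensity s z.1 z.2 := by
  unfold gaussDensity
  fun_prop

theorem gaussDensity_eq_mul_exp (s : ℝ) (a y : V) :
    gaussDensity s a y =
      gaussDensity s 0 y * Real.exp ((2 * inner ℝ y a - ‖a‖ ^ 2) / s) := by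
  rw [gaussDensity, gaussDensity, mul_assoc, ← Real.exp_add, sub_zero, norm_sub_sq_real]
  congr 2
  ring

theorem gaussDensity_add_right (s : ℝ) (a y : V) :
    gaussDensity s a (y + a) = gaussDensity s 0 y := by
  simp only [gaussDensity, add_sub_cancel_right, sub_zero]

theorem gaussDensity_zero_neg (s : ℝ) (y : V) : gaussDensity s 0 (-y) = gaussDensity s 0 y := by
  simp only [gaussDensity, sub_zero, norm_neg]

theorem gaussDensity_add_right_mul_inner (s : ℝ) (a y : V) :
    gaussDensity s a (y + a) * inner ℝ (y + a) a =
      gaussDensity s 0 y * inner ℝ y a + gaussDensity s 0 y * ‖a‖ ^ 2 := by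
  rw [gaussDensity_add_right, inner_add_left, real_inner_self_eq_norm_sq, mul_add]

theorem klDensity_gaussDensity {s : ℝ} (hs : 0 < s) (a y : V) :
    klDensity (gaussDensity s a y) (gaussDensity s 0 y) =
      gaussDensity s 0 y * klFun (Real.exp ((2 * inner ℝ y a - ‖a‖ ^ 2) / s)) := by
  rw [klDensity, gaussDensity_eq_mul_exp s a, mul_div_cancel_left₀ _ (gaussDensity_pos hs 0 y).ne']

theorem abs_two_mul_inner_smul_sub_le {ε : ℝ} (hε : |ε| ≤ 1) (a y : V) :
    |2 * inner ℝ y (ε • a) - ‖ε • a‖ ^ 2| ≤ |ε| * (2 * (‖y‖ * ‖a‖) + ‖a‖ ^ 2) := by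
  calc |2 * inner ℝ y (ε • a) - ‖ε • a‖ ^ 2|
      ≤ |2 * inner ℝ y (ε • a)| + |‖ε • a‖ ^ 2| := abs_sub _ _
    _ = |ε| * (2 * |inner ℝ y a| + |ε| * ‖a‖ ^ 2) := by
      rw [inner_smul_right, norm_smul, abs_mul, abs_mul, abs_two, abs_sq, Real.norm_eq_abs]
      ring
    _ ≤ |ε| * (2 * (‖y‖ * ‖a‖) + 1 * ‖a‖ ^ 2) := by
      gcongr
      exact abs_real_inner_le_norm y a
    _ = |ε| * (2 * (‖y‖ * ‖a‖) + ‖a‖ ^ 2) := by rw [one_mul]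

theorem klDensity_gaussDensity_smul_le {s : ℝ} (hs : 0 < s) {ε : ℝ} (hε : |ε| ≤ 1) (a y : V) :
    klDensity (gaussDensity s (ε • a) y) (gaussDensity s 0 y) ≤
      ε ^ 2 * (2 * Real.exp (2 * ‖a‖ ^ 2 / s) *
        (gaussDensity s 0 y * Real.exp (4 * ‖a‖ / s * ‖y‖))) := by
  set τ := (2 * (‖y‖ * ‖a‖) + ‖a‖ ^ 2) / s with hτ
  have ht : |(2 * inner ℝ y (ε • a) - ‖ε • a‖ ^ 2) / s| ≤ |ε| * τ := by
    rw [hτ, abs_div, abs_of_pos hs, ← mul_div_assoc]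
    gcongr
    exact abs_two_mul_inner_smul_sub_le hε a y
  have hτ_split : 2 * τ = 2 * ‖a‖ ^ 2 / s + 4 * ‖a‖ / s * ‖y‖ := by rw [hτ]; ring
  calc klDensity (gaussDensity s (ε • a) y) (gaussDensity s 0 y)
      = gaussDensity s 0 y * klFun (Real.exp ((2 * inner ℝ y (ε • a) - ‖ε • a‖ ^ 2) / s)) :=
        klDensity_gaussDensity hs _ y
    _ ≤ gaussDensity s 0 y * (ε ^ 2 * (2 * Real.exp (2 * τ))) :=
        mul_le_mul_of_nonneg_left (klFun_exp_le_sq_mul_exp hε (by positivity) ht)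
          (gaussDensity_pos hs 0 y).le
    _ = _ := by rw [hτ_split, Real.exp_add]; ring

variable [MeasurableSpace V] [BorelSpace V]

theorem measurable_gaussDensity (s : ℝ) (a : V) : Measurable (gaussDensity s a) :=
  ((continuous_gaussDensity s).comp (.prodMk_right a)).measurable

variable [FiniteDimensional ℝ V]

theorem integral_gaussDensity {s : ℝ} (hs : 0 < s) (a : V) : ∫ y, gaussDensity s a y = 1 := by
  have hconst : (0 : ℝ) < (s * Real.pi) ^ ((Module.finrank ℝ V : ℝ) / 2) := by positivity
  calc ∫ y, gaussDensity s a y = ∫ y : V, gaussDensity s 0 y := by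
        simp only [← integral_add_right_eq_self (gaussDensity s a) a, gaussDensity_add_right]
    _ = 1 / (s * Real.pi) ^ ((Module.finrank ℝ V : ℝ) / 2) *
          ∫ y : V, Real.exp (-s⁻¹ * ‖y‖ ^ 2) := by
        simp only [gaussDensity, sub_zero, integral_const_mul, neg_mul, div_eq_inv_mul]
    _ = 1 := by
        rw [GaussianFourier.integral_rexp_neg_mul_sq_norm (inv_pos.2 hs), div_inv_eq_mul,
          mul_comm Real.pi, one_div_mul_cancel hconst.ne']

theorem integrable_gaussDensity {s : ℝ} (hs : 0 < s) (a : V) :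
    Integrable (gaussDensity s a) :=
  Integrable.of_integral_ne_zero (by rw [integral_gaussDensity hs]; exact one_ne_zero)

theorem integrable_gaussDensity_mul_exp_norm {s : ℝ} (hs : 0 < s) (c : ℝ) :
    Integrable fun y : V => gaussDensity s 0 y * Real.exp (c * ‖y‖) := by
  set A : ℝ := 1 / (s * Real.pi) ^ ((Module.finrank ℝ V : ℝ) / 2)
  set B : ℝ := 1 / (2 * s * Real.pi) ^ ((Module.finrank ℝ V : ℝ) / 2)
  have hA : 0 < A := by positivity
  have hB : 0 < B := by positivity
  refine ((integrable_gaussDensity (mul_pos two_pos hs) (0 : V)).const_mul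
    (A / B * Real.exp (c ^ 2 * s / 2))).mono'
    ((measurable_gaussDensity s 0).mul (by fun_prop)).aestronglyMeasurable
    (Eventually.of_forall fun y => ?_)
  have hexp : -(‖y‖ ^ 2 / s) + c * ‖y‖ ≤ c ^ 2 * s / 2 + -(‖y‖ ^ 2 / (2 * s)) := by
    have hsq : 0 ≤ (‖y‖ - c * s) ^ 2 / (2 * s) := by positivity
    have hexpand : (‖y‖ - c * s) ^ 2 / (2 * s) =
        c ^ 2 * s / 2 + -(‖y‖ ^ 2 / (2 * s)) - (-(‖y‖ ^ 2 / s) + c * ‖y‖) := by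
      field_simp
      ring
    linarith
  rw [Real.norm_of_nonneg (mul_pos (gaussDensity_pos hs 0 y) (Real.exp_pos _)).le]
  calc gaussDensity s 0 y * Real.exp (c * ‖y‖)
      = A * Real.exp (-(‖y‖ ^ 2 / s) + c * ‖y‖) := by
        rw [gaussDensity, sub_zero, mul_assoc, ← Real.exp_add]
    _ ≤ A * Real.exp (c ^ 2 * s / 2 + -(‖y‖ ^ 2 / (2 * s))) := by gcongr
    _ = A / B * Real.exp (c ^ 2 * s / 2) * gaussDensity (2 * s) 0 y := by
        have hgauss : gaussDensity (2 * s) 0 y = B * Real.exp (-(‖y‖ ^ 2 / (2 * s))) := by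
          rw [gaussDensity, sub_zero]
        rw [hgauss, Real.exp_add]
        field_simp

theorem integrable_gaussDensity_zero_mul_inner {s : ℝ} (hs : 0 < s) (a : V) :
    Integrable fun y : V => gaussDensity s 0 y * inner ℝ y a := by
  refine ((integrable_gaussDensity_mul_exp_norm hs 1).const_mul ‖a‖).mono'
    ((measurable_gaussDensity s 0).mul (by fun_prop)).aestronglyMeasurable
    (Eventually.of_forall fun y => ?_)
  have hinner : |inner ℝ y a| ≤ Real.exp (1 * ‖y‖) * ‖a‖ :=
    (abs_real_inner_le_norm y a).trans (by
      gcongr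
      linarith [Real.add_one_le_exp (1 * ‖y‖)])
  rw [norm_mul, Real.norm_of_nonneg (gaussDensity_pos hs 0 y).le, Real.norm_eq_abs]
  calc gaussDensity s 0 y * |inner ℝ y a|
      ≤ gaussDensity s 0 y * (Real.exp (1 * ‖y‖) * ‖a‖) :=
        mul_le_mul_of_nonneg_left hinner (gaussDensity_pos hs 0 y).le
    _ = ‖a‖ * (gaussDensity s 0 y * Real.exp (1 * ‖y‖)) := by ring

theorem integral_gaussDensity_zero_mul_inner (s : ℝ) (a : V) :
    ∫ y : V, gaussDensity s 0 y * inner ℝ y a = 0 := by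
  have hodd := integral_neg_eq_self (fun y : V => gaussDensity s 0 y * inner ℝ y a) volume
  simp only [gaussDensity_zero_neg, inner_neg_left, mul_neg, integral_neg] at hodd
  exact self_eq_neg.1 hodd.symm

theorem integrable_gaussDensity_mul_inner {s : ℝ} (hs : 0 < s) (a : V) :
    Integrable fun y => gaussDensity s a y * inner ℝ y a := by
  have h := (integrable_gaussDensity_zero_mul_inner hs a).add
    ((integrable_gaussDensity hs (0 : V)).mul_const (‖a‖ ^ 2))
  have hshift := (h.congr (Eventually.of_forall fun y =>
    (gaussDensity_add_right_mul_inner s a y).symm)).comp_sub_right a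
  simpa only [sub_add_cancel] using hshift

theorem integral_gaussDensity_mul_inner {s : ℝ} (hs : 0 < s) (a : V) :
    ∫ y, gaussDensity s a y * inner ℝ y a = ‖a‖ ^ 2 := by
  rw [← integral_add_right_eq_self _ a]
  simp only [gaussDensity_add_right_mul_inner]
  rw [integral_add (integrable_gaussDensity_zero_mul_inner hs a)
      ((integrable_gaussDensity hs 0).mul_const _), integral_gaussDensity_zero_mul_inner,
    integral_mul_const, integral_gaussDensity hs, zero_add, one_mul]

theorem exists_integrable_klDensity_gaussDensity_smul_le {s : ℝ} (hs : 0 < s) (a : V) :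
    ∃ G : V → ℝ, Integrable G ∧ ∀ ε : ℝ, |ε| ≤ 1 → ∀ y,
      klDensity (gaussDensity s (ε • a) y) (gaussDensity s 0 y) ≤ ε ^ 2 * G y :=
  ⟨_, (integrable_gaussDensity_mul_exp_norm hs _).const_mul _,
    fun _ hε y => klDensity_gaussDensity_smul_le hs hε a y⟩

theorem integrable_klDensity_gaussDensity {s : ℝ} (hs : 0 < s) (a : V) :
    Integrable fun y => klDensity (gaussDensity s a y) (gaussDensity s 0 y) := by
  obtain ⟨G, hG, hle⟩ := exists_integrable_klDensity_gaussDensity_smul_le hs a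
  refine hG.mono' (measurable_klDensity (measurable_gaussDensity s a)
    (measurable_gaussDensity s 0)).aestronglyMeasurable (Eventually.of_forall fun y => ?_)
  rw [Real.norm_of_nonneg
    (klDensity_nonneg (gaussDensity_pos hs a y).le (gaussDensity_pos hs 0 y).le)]
  simpa using hle 1 (by simp) y

theorem integral_klDensity_gaussDensity {s : ℝ} (hs : 0 < s) (a : V) :
    ∫ y, klDensity (gaussDensity s a y) (gaussDensity s 0 y) = ‖a‖ ^ 2 / s := by
  have hlog : ∀ y, gaussDensity s a y * Real.log (gaussDensity s a y / gaussDensity s 0 y) =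
      2 / s * (gaussDensity s a y * inner ℝ y a) - ‖a‖ ^ 2 / s * gaussDensity s a y := fun y => by
    rw [gaussDensity_eq_mul_exp s a, mul_div_cancel_left₀ _ (gaussDensity_pos hs 0 y).ne',
      Real.log_exp]
    ring
  rw [← integral_mul_log_div (fun y => (gaussDensity_pos hs 0 y).ne') (integrable_gaussDensity hs a)
    (integrable_gaussDensity hs 0) (by rw [integral_gaussDensity hs, integral_gaussDensity hs])
    (integrable_klDensity_gaussDensity hs a)]
  simp only [hlog]
  rw [integral_sub ((integrable_gaussDensity_mul_inner hs a).const_mul _)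
      ((integrable_gaussDensity hs a).const_mul _),
    integral_const_mul, integral_const_mul, integral_gaussDensity_mul_inner hs,
    integral_gaussDensity hs]
  ring

end Gaussian

section Mixture

variable {ι V : Type*} [Fintype ι] [NormedAddCommGroup V] [InnerProductSpace ℝ V]

/-- The density of the Gaussian mixture with weights `v` and centers `a`: the output density of an
additive Gaussian noise channel whose input is `a i` with probability `v i`. -/
noncomputable def gaussMixture (s : ℝ) (v : ι → ℝ) (a : ι → V) (y : V) : ℝ :=
  ∑ i, v i * gaussDensity s (a i) y

variable {s : ℝ} {v : ι → ℝ}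

theorem gaussMixture_pos (hs : 0 < s) (hv : v ∈ stdSimplex ℝ ι) (a : ι → V) (y : V) :
    0 < gaussMixture s v a y := by
  obtain ⟨i, -, hi⟩ : ∃ i ∈ Finset.univ, 0 < v i :=
    Finset.exists_lt_of_sum_lt (by simp [hv.2])
  exact Finset.sum_pos' (fun j _ => mul_nonneg (hv.1 j) (gaussDensity_pos hs _ y).le)
    ⟨i, Finset.mem_univ i, mul_pos hi (gaussDensity_pos hs _ y)⟩

theorem gaussMixture_div_gaussDensity (hs : 0 < s) (v : ι → ℝ) (a : ι → V) (y : V) :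
    gaussMixture s v a y / gaussDensity s 0 y =
      ∑ i, v i * Real.exp ((2 * inner ℝ y (a i) - ‖a i‖ ^ 2) / s) := by
  rw [gaussMixture, Finset.sum_div]
  refine Finset.sum_congr rfl fun i _ => ?_
  rw [gaussDensity_eq_mul_exp, mul_left_comm, mul_div_cancel_left₀ _ (gaussDensity_pos hs 0 y).ne']

theorem hasDerivAt_gaussMixture_smul_div (hs : 0 < s) (v : ι → ℝ) (a : ι → V) (y : V) :
    HasDerivAt (fun ε : ℝ => gaussMixture s v (ε • a) y / gaussDensity s 0 y)
      (2 / s * inner ℝ y (∑ i, v i • a i)) 0 := by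
  have hexponent : ∀ i, HasDerivAt
      (fun ε : ℝ => (2 * inner ℝ y (ε • a i) - ‖ε • a i‖ ^ 2) / s) (2 / s * inner ℝ y (a i)) 0 := by
    intro i
    simp only [inner_smul_right, norm_smul, mul_pow, Real.norm_eq_abs, sq_abs]
    have hlin := ((hasDerivAt_id (0 : ℝ)).mul_const (inner ℝ y (a i))).const_mul 2
    have hquad := ((hasDerivAt_id (0 : ℝ)).fun_pow 2).mul_const (‖a i‖ ^ 2)
    exact ((hlin.sub hquad).div_const s).congr_deriv (by simp; ring)
  simp only [gaussMixture_div_gaussDensity hs]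
  refine (HasDerivAt.fun_sum fun i _ => ((hexponent i).exp.const_mul (v i))).congr_deriv ?_
  simp [inner_sum, inner_smul_right, Finset.mul_sum, mul_left_comm]

theorem tendsto_klDensity_gaussMixture_smul (hs : 0 < s) (hv : ∑ i, v i = 1) (a : ι → V) (y : V) :
    Tendsto (fun ε : ℝ => klDensity (gaussMixture s v (ε • a) y) (gaussDensity s 0 y) / ε ^ 2)
      (𝓝[≠] 0) (𝓝 (gaussDensity s 0 y * ((2 / s * inner ℝ y (∑ i, v i • a i)) ^ 2 / 2))) := by
  have hone : gaussMixture s v ((0 : ℝ) • a) y / gaussDensity s 0 y = 1 := by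
    simp [gaussMixture_div_gaussDensity hs, hv]
  simpa only [klDensity, mul_div_assoc] using
    (tendsto_klFun_div_sq (hasDerivAt_gaussMixture_smul_div hs v a y) hone).const_mul
      (gaussDensity s 0 y)

theorem klDensity_gaussMixture_nonneg (hs : 0 < s) (hv : v ∈ stdSimplex ℝ ι) (a : ι → V) (y : V) :
    0 ≤ klDensity (gaussMixture s v a y) (gaussDensity s 0 y) :=
  klDensity_nonneg (gaussMixture_pos hs hv a y).le (gaussDensity_pos hs 0 y).le

theorem klDensity_gaussMixture_le (hs : 0 < s) (hv : v ∈ stdSimplex ℝ ι) (a : ι → V) (y : V) :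
    klDensity (gaussMixture s v a y) (gaussDensity s 0 y) ≤
      ∑ i, v i * klDensity (gaussDensity s (a i) y) (gaussDensity s 0 y) :=
  klDensity_sum_le hv (fun i => (gaussDensity_pos hs (a i) y).le) (gaussDensity_pos hs 0 y).le

variable [MeasurableSpace V] [BorelSpace V]

theorem measurable_gaussMixture (s : ℝ) (v : ι → ℝ) (a : ι → V) :
    Measurable (gaussMixture s v a) :=
  Finset.measurable_sum _ fun i _ => (measurable_gaussDensity s (a i)).const_mul (v i)

variable [FiniteDimensional ℝ V]

theorem integrable_gaussMixture (hs : 0 < s) (v : ι → ℝ) (a : ι → V) :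
    Integrable (gaussMixture s v a) :=
  integrable_finsetSum _ fun i _ => (integrable_gaussDensity hs (a i)).const_mul (v i)

theorem integral_gaussMixture (hs : 0 < s) (hv : ∑ i, v i = 1) (a : ι → V) :
    ∫ y, gaussMixture s v a y = 1 := by
  simp only [gaussMixture]
  rw [integral_finsetSum _ fun i _ => (integrable_gaussDensity hs (a i)).const_mul (v i)]
  simp only [integral_const_mul, integral_gaussDensity hs, mul_one, hv]

/-- The Kullback–Leibler divergence, in nats, of a Gaussian mixture from the pure noise, that is,
from the Gaussian with the same covariance centered at `0`. -/
noncomputable def noiseDivergence (s : ℝ) (v : ι → ℝ) (a : ι → V) : ℝ :=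
  ∫ y, klDensity (gaussMixture s v a y) (gaussDensity s 0 y)

theorem integrable_klDensity_gaussMixture (hs : 0 < s) (hv : v ∈ stdSimplex ℝ ι) (a : ι → V) :
    Integrable fun y => klDensity (gaussMixture s v a y) (gaussDensity s 0 y) :=
  integrable_klDensity_sum hv (fun i => measurable_gaussDensity s (a i))
    (fun i y => (gaussDensity_pos hs (a i) y).le) (measurable_gaussDensity s 0)
    (fun y => (gaussDensity_pos hs 0 y).le) fun i => integrable_klDensity_gaussDensity hs (a i)

theorem noiseDivergence_nonneg (hs : 0 < s) (hv : v ∈ stdSimplex ℝ ι) (a : ι → V) :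
    0 ≤ noiseDivergence s v a :=
  integral_nonneg fun y => klDensity_gaussMixture_nonneg hs hv a y

theorem noiseDivergence_le (hs : 0 < s) (hv : v ∈ stdSimplex ℝ ι) (a : ι → V) :
    noiseDivergence s v a ≤ ∑ i, v i * (‖a i‖ ^ 2 / s) := by
  have hint := fun i => (integrable_klDensity_gaussDensity hs (a i)).const_mul (v i)
  calc noiseDivergence s v a
      ≤ ∫ y, ∑ i, v i * klDensity (gaussDensity s (a i) y) (gaussDensity s 0 y) :=
        integral_mono (integrable_klDensity_gaussMixture hs hv a)
          (integrable_finsetSum _ fun i _ => hint i) (klDensity_gaussMixture_le hs hv a)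
    _ = ∑ i, v i * (‖a i‖ ^ 2 / s) := by
        rw [integral_finsetSum _ fun i _ => hint i]
        simp only [integral_const_mul, integral_klDensity_gaussDensity hs]

theorem noiseDivergence_zero (hs : 0 < s) (hv : v ∈ stdSimplex ℝ ι) :
    noiseDivergence s v (0 : ι → V) = 0 :=
  le_antisymm (by simpa using noiseDivergence_le hs hv (0 : ι → V)) (noiseDivergence_nonneg hs hv 0)

theorem tendsto_noiseDivergence_smul_div_sq_integral (hs : 0 < s) (hv : v ∈ stdSimplex ℝ ι)
    (a : ι → V) :
    Tendsto (fun ε : ℝ => noiseDivergence s v (ε • a) / ε ^ 2) (𝓝[≠] 0)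
      (𝓝 (∫ y, gaussDensity s 0 y * ((2 / s * inner ℝ y (∑ i, v i • a i)) ^ 2 / 2))) := by
  choose G hG hle using fun i => exists_integrable_klDensity_gaussDensity_smul_le hs (a i)
  refine Tendsto.congr (fun ε => integral_div (ε ^ 2) _)
    (tendsto_integral_filter_of_dominated_convergence (fun y => ∑ i, v i * G i y)
      (Eventually.of_forall fun ε => ?_) ?_
      (integrable_finsetSum _ fun i _ => (hG i).const_mul (v i))
      (Eventually.of_forall fun y => tendsto_klDensity_gaussMixture_smul hs hv.2 a y))
  · exact ((measurable_klDensity (measurable_gaussMixture s v _)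
      (measurable_gaussDensity s 0)).div_const _).aestronglyMeasurable
  · have hsmall : ∀ᶠ ε : ℝ in 𝓝[≠] 0, |ε| ≤ 1 :=
      nhdsWithin_le_nhds ((continuous_abs.tendsto' 0 0 abs_zero).eventually_le_const one_pos)
    filter_upwards [hsmall, self_mem_nhdsWithin] with ε hε (hε0 : ε ≠ 0)
    refine Eventually.of_forall fun y => ?_
    rw [Real.norm_of_nonneg (div_nonneg (klDensity_gaussMixture_nonneg hs hv _ y) (sq_nonneg ε)),
      div_le_iff₀ (by positivity), Finset.sum_mul]
    refine (klDensity_gaussMixture_le hs hv _ y).trans (Finset.sum_le_sum fun i _ => ?_)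
    rw [mul_assoc, mul_comm (G i y)]
    exact mul_le_mul_of_nonneg_left (hle i ε hε y) (hv.1 i)

-- For a single component the divergence is exactly `ε ^ 2 * ‖a‖ ^ 2 / s`, so uniqueness of limits
-- evaluates the second moment.
theorem integral_gaussDensity_mul_inner_sq (hs : 0 < s) (a : V) :
    ∫ y, gaussDensity s 0 y * ((2 / s * inner ℝ y a) ^ 2 / 2) = ‖a‖ ^ 2 / s := by
  have hsingle : (fun _ : Unit => (1 : ℝ)) ∈ stdSimplex ℝ Unit := ⟨fun _ => zero_le_one, by simp⟩
  have hlim := tendsto_noiseDivergence_smul_div_sq_integral hs hsingle fun _ => a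
  simp only [Finset.univ_unique, Finset.sum_singleton, one_smul] at hlim
  refine tendsto_nhds_unique hlim (tendsto_const_nhds.congr' ?_)
  filter_upwards [self_mem_nhdsWithin] with ε (hε : ε ≠ 0)
  have hexact : noiseDivergence s (fun _ : Unit => (1 : ℝ)) (ε • fun _ => a) =
      ‖ε • a‖ ^ 2 / s := by
    simp [noiseDivergence, gaussMixture, integral_klDensity_gaussDensity hs]
  rw [hexact, norm_smul, mul_pow, Real.norm_eq_abs, sq_abs]
  field_simp

theorem tendsto_noiseDivergence_smul_div_sq (hs : 0 < s) (hv : v ∈ stdSimplex ℝ ι) (a : ι → V) :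
    Tendsto (fun ε : ℝ => noiseDivergence s v (ε • a) / ε ^ 2) (𝓝[≠] 0)
      (𝓝 (‖∑ i, v i • a i‖ ^ 2 / s)) := by
  rw [← integral_gaussDensity_mul_inner_sq hs]
  exact tendsto_noiseDivergence_smul_div_sq_integral hs hv a

section RandomCenters

variable {Ω : Type*} [MeasurableSpace Ω] {P : Measure Ω} {a : Ω → ι → V}

theorem measurable_noiseDivergence (s : ℝ) (v : ι → ℝ) (ha : Measurable a) :
    Measurable fun ω => noiseDivergence s v (a ω) := by
  have hmix : Measurable fun z : Ω × V => gaussMixture s v (a z.1) z.2 :=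
    Finset.measurable_sum _ fun i _ => Measurable.const_mul
      ((continuous_gaussDensity s).measurable.comp
        (((measurable_pi_apply i).comp (ha.comp measurable_fst)).prodMk measurable_snd)) _
  exact (measurable_klDensity hmix ((measurable_gaussDensity s 0).comp
    measurable_snd)).stronglyMeasurable.integral_prod_right'.measurable

theorem integrable_noiseDivergence (hs : 0 < s) (hv : v ∈ stdSimplex ℝ ι) (ha : Measurable a)
    (ha2 : ∀ i, Integrable (fun ω => ‖a ω i‖ ^ 2) P) :
    Integrable (fun ω => noiseDivergence s v (a ω)) P := by
  refine (integrable_finsetSum Finset.univ fun i _ => ((ha2 i).div_const s).const_mul (v i)).mono'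
    (measurable_noiseDivergence s v ha).aestronglyMeasurable (Eventually.of_forall fun ω => ?_)
  rw [Real.norm_of_nonneg (noiseDivergence_nonneg hs hv _)]
  exact noiseDivergence_le hs hv (a ω)

theorem tendsto_integral_noiseDivergence_smul_div_sq (hs : 0 < s) (hv : v ∈ stdSimplex ℝ ι)
    (ha : Measurable a) (ha2 : ∀ i, Integrable (fun ω => ‖a ω i‖ ^ 2) P) :
    Tendsto (fun ε : ℝ => (∫ ω, noiseDivergence s v (ε • a ω) ∂P) / ε ^ 2) (𝓝[≠] 0)
      (𝓝 ((∫ ω, ‖∑ i, v i • a ω i‖ ^ 2 ∂P) / s)) := by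
  rw [← integral_div]
  refine Tendsto.congr (fun ε => integral_div (ε ^ 2) _)
    (tendsto_integral_filter_of_dominated_convergence
      (fun ω => ∑ i, v i * (‖a ω i‖ ^ 2 / s)) (Eventually.of_forall fun ε => ?_) ?_
      (integrable_finsetSum _ fun i _ => ((ha2 i).div_const s).const_mul (v i))
      (Eventually.of_forall fun ω => tendsto_noiseDivergence_smul_div_sq hs hv (a ω)))
  · exact ((measurable_noiseDivergence s v (ha.const_smul ε)).div_const _).aestronglyMeasurable
  · filter_upwards [self_mem_nhdsWithin] with ε (hε : ε ≠ 0)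
    refine Eventually.of_forall fun ω => ?_
    rw [Real.norm_of_nonneg (div_nonneg (noiseDivergence_nonneg hs hv _) (sq_nonneg ε)),
      div_le_iff₀ (by positivity), Finset.sum_mul]
    refine (noiseDivergence_le hs hv _).trans_eq (Finset.sum_congr rfl fun i _ => ?_)
    rw [Pi.smul_apply, norm_smul, mul_pow, Real.norm_eq_abs, sq_abs]
    ring

end RandomCenters

end Mixture

section BitLabels

variable {m : ℕ}

theorem nbcBit_injective (m : ℕ) : Function.Injective (nbcBit (m := m)) := by
  intro i j h
  refine Fin.ext (Nat.eq_of_testBit_eq fun k => ?_)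
  rcases lt_or_ge k m with hk | hk
  · exact congrFun h ⟨k, hk⟩
  · have hle : 2 ^ m ≤ 2 ^ k := Nat.pow_le_pow_right two_pos hk
    rw [Nat.testBit_lt_two_pow (i.2.trans_le hle), Nat.testBit_lt_two_pow (j.2.trans_le hle)]

theorem nbcBit_bijective (m : ℕ) : Function.Bijective (nbcBit (m := m)) :=
  (Fintype.bijective_iff_injective_and_card _).2 ⟨nbcBit_injective m, by simp⟩

theorem sum_prod_nbcBit {R : Type*} [CommSemiring R] (f : Fin m → Bool → R) :
    ∑ i, ∏ k, f k (nbcBit i k) = ∏ k, ∑ u, f k u := by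
  rw [Fintype.sum_bijective _ (nbcBit_bijective m) _ (fun x => ∏ k, f k (x k)) fun _ => rfl,
    Finset.prod_univ_sum, Fintype.piFinset_univ]

theorem sum_bitProb (b : Fin m → ℝ) (k : Fin m) : ∑ u, bitProb b k u = 1 := by
  simp [bitProb]

theorem bitProb_nonneg {b : Fin m → ℝ} {k : Fin m} (hb : b k ∈ Set.Icc 0 1) (u : Bool) :
    0 ≤ bitProb b k u := by
  cases u
  · exact hb.1
  · exact sub_nonneg.2 hb.2

theorem bitProb_pos {b : Fin m → ℝ} {k : Fin m} (hb : b k ∈ Set.Ioo 0 1) (u : Bool) :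
    0 < bitProb b k u := by
  cases u
  · exact hb.1
  · exact sub_pos.2 hb.2

theorem bitProb_mem_stdSimplex {b : Fin m → ℝ} {k : Fin m} (hb : b k ∈ Set.Icc 0 1) :
    bitProb b k ∈ stdSimplex ℝ Bool :=
  ⟨bitProb_nonneg hb, sum_bitProb b k⟩

theorem symbolProb_mem_stdSimplex {b : Fin m → ℝ} (hb : ∀ k, b k ∈ Set.Icc 0 1) :
    symbolProb b ∈ stdSimplex ℝ (Fin (2 ^ m)) :=
  ⟨fun _ => Finset.prod_nonneg fun k _ => bitProb_nonneg (hb k) _, by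
    simp only [symbolProb, sum_prod_nbcBit, sum_bitProb, Finset.prod_const_one]⟩

theorem symbolProb_update (b : Fin m → ℝ) (k : Fin m) (t : ℝ) (i : Fin (2 ^ m)) :
    symbolProb (Function.update b k t) i =
      (if nbcBit i k then 1 - t else t) *
        ∏ l ∈ Finset.univ.erase k, bitProb b l (nbcBit i l) := by
  rw [symbolProb, ← Finset.mul_prod_erase _ _ (Finset.mem_univ k)]
  congr 1
  · simp [bitProb]
  · refine Finset.prod_congr rfl fun l hl => ?_
    simp [bitProb, Function.update_of_ne (Finset.ne_of_mem_erase hl)]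

theorem symbolProb_eq_mul_prod_erase (b : Fin m → ℝ) (k : Fin m) (i : Fin (2 ^ m)) :
    symbolProb b i =
      bitProb b k (nbcBit i k) * ∏ l ∈ Finset.univ.erase k, bitProb b l (nbcBit i l) :=
  (Finset.mul_prod_erase _ _ (Finset.mem_univ k)).symm

/-- The bit probabilities `b` conditioned on bit number `k` being `u`: as `b k` is the probability
of the value `0`, its entry becomes `1` for `u = 0` and `0` for `u = 1`. -/
def fixBit (b : Fin m → ℝ) (k : Fin m) (u : Bool) : Fin m → ℝ :=
  Function.update b k (if u then 0 else 1)

theorem fixBit_mem_Icc {b : Fin m → ℝ} (hb : ∀ k, b k ∈ Set.Icc 0 1) (k : Fin m) (u : Bool)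
    (l : Fin m) : fixBit b k u l ∈ Set.Icc 0 1 := by
  rcases eq_or_ne l k with rfl | hl
  · cases u <;> simp [fixBit]
  · simpa [fixBit, hl] using hb l

theorem symbolProb_update_eq_fixBit (b : Fin m → ℝ) (k : Fin m) (t : ℝ) (i : Fin (2 ^ m)) :
    symbolProb (Function.update b k t) i =
      t * symbolProb (fixBit b k false) i + (1 - t) * symbolProb (fixBit b k true) i := by
  simp only [fixBit, symbolProb_update]
  cases nbcBit i k <;> simp

theorem symbolProb_eq_sum_fixBit (b : Fin m → ℝ) (k : Fin m) (i : Fin (2 ^ m)) :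
    symbolProb b i = ∑ u, bitProb b k u * symbolProb (fixBit b k u) i := by
  conv_lhs => rw [← Function.update_eq_self k b, symbolProb_update_eq_fixBit]
  simp [bitProb, add_comm]

theorem condSymbolProb_eq_symbolProb_fixBit {b : Fin m → ℝ} {k : Fin m} {u : Bool}
    (hu : bitProb b k u ≠ 0) : condSymbolProb b k u = symbolProb (fixBit b k u) := by
  funext i
  rw [condSymbolProb, symbolProb_eq_mul_prod_erase b k, fixBit, symbolProb_update]
  by_cases hi : nbcBit i k = u
  · rw [if_pos hi, hi, mul_div_cancel_left₀ _ hu]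
    cases u <;> simp
  · cases u <;> simp_all

variable {N : ℕ}

theorem mean_update (b : Fin m → ℝ) (X : Fin (2 ^ m) → EuclideanSpace ℝ (Fin N)) (k : Fin m)
    (t : ℝ) :
    mean (Function.update b k t) X =
      t • mean (fixBit b k false) X + (1 - t) • mean (fixBit b k true) X := by
  simp only [mean, symbolProb_update_eq_fixBit b k t, add_smul, mul_smul, Finset.sum_add_distrib,
    Finset.smul_sum]

/-- The difference of the conditional means of the input given the two values of bit number `k`,
scaled by the standard deviation `√(P(C_k = 0) P(C_k = 1))` of that bit. Its squared norm is the
contribution of bit number `k` to the low-energy behaviour of the mutual information. -/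
noncomputable def bitContrast (b : Fin m → ℝ) (X : Fin (2 ^ m) → EuclideanSpace ℝ (Fin N))
    (k : Fin m) : EuclideanSpace ℝ (Fin N) :=
  √(b k * (1 - b k)) • (mean (fixBit b k false) X - mean (fixBit b k true) X)

theorem sum_bitProb_mul_norm_mean_fixBit_sq_sub {b : Fin m → ℝ} {k : Fin m}
    (hb : b k ∈ Set.Icc 0 1) (X : Fin (2 ^ m) → EuclideanSpace ℝ (Fin N)) :
    ∑ u, bitProb b k u * ‖mean (fixBit b k u) X‖ ^ 2 - ‖mean b X‖ ^ 2 =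
      ‖bitContrast b X k‖ ^ 2 := by
  have hmean := mean_update b X k (b k)
  rw [Function.update_eq_self] at hmean
  rw [hmean, bitContrast, norm_smul, mul_pow, Real.norm_eq_abs, sq_abs,
    Real.sq_sqrt (mul_nonneg hb.1 (sub_nonneg.2 hb.2)), norm_add_sq_real, norm_sub_sq_real,
    norm_smul, norm_smul, inner_smul_left, inner_smul_right, mul_pow, mul_pow, Real.norm_eq_abs,
    Real.norm_eq_abs, sq_abs, sq_abs, Fintype.sum_bool]
  simp only [bitProb, if_true, Bool.false_eq_true, if_false, conj_trivial]
  ring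

end BitLabels

section Transform

variable {m N : ℕ}

/-- The bit probabilities `b` displaced by `ξ k` standard deviations `√(P(C_k = 0) P(C_k = 1))` of
each bit. They need not lie in `[0, 1]`; `symbolProb` and `mean` are then the multiaffine extensions
of the symbol probabilities and of the mean. -/
noncomputable def shiftBits (b ξ : Fin m → ℝ) : Fin m → ℝ :=
  fun k => b k + ξ k * √(b k * (1 - b k))

/-- The antipodal (BPSK) image `(-1) ^ u` of a bit `u`. -/
def antipodal (u : Bool) : ℝ :=
  if u then -1 else 1

/-- The bit probabilities `b` displaced by one standard deviation each, in the directions given by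
the label of symbol number `i`. The transform is the mean under these signed bit probabilities. -/
noncomputable def signedBits (b : Fin m → ℝ) (i : Fin (2 ^ m)) : Fin m → ℝ :=
  shiftBits b fun k => antipodal (nbcBit i k)

theorem gammaCoeff_mul_sqrt_symbolProb {b : Fin m → ℝ} (hb : ∀ k, b k ∈ Set.Icc 0 1)
    (i j : Fin (2 ^ m)) :
    gammaCoeff b i j * √(symbolProb b j) = symbolProb (signedBits b i) j := by
  rw [symbolProb, Real.sqrt_prod _ fun k _ => bitProb_nonneg (hb k) _, gammaCoeff,
    ← Finset.prod_mul_distrib]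
  refine Finset.prod_congr rfl fun k _ => ?_
  have h0 : √(b k) * √(b k) = b k := Real.mul_self_sqrt (hb k).1
  have h1 : √(1 - b k) * √(1 - b k) = 1 - b k := Real.mul_self_sqrt (sub_nonneg.2 (hb k).2)
  have hσ : √(b k * (1 - b k)) = √(b k) * √(1 - b k) := Real.sqrt_mul (hb k).1 _
  simp only [bitProb, signedBits, shiftBits, antipodal, hσ]
  cases nbcBit i k <;> cases nbcBit j k <;>
    simp only [Bool.not_false, Bool.not_true, Bool.toNat_false, Bool.toNat_true, if_true,
      Bool.false_eq_true, if_false] <;>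
    first | linear_combination h0 | linear_combination h1

theorem newTransform_eq_mean_signedBits {b : Fin m → ℝ} (hb : ∀ k, b k ∈ Set.Icc 0 1)
    (X : Fin (2 ^ m) → EuclideanSpace ℝ (Fin N)) (i : Fin (2 ^ m)) :
    newTransform b X i = mean (signedBits b i) X := by
  simp only [newTransform, mean, gammaCoeff_mul_sqrt_symbolProb hb]

theorem sum_symbolProb_mul_symbolProb_signedBits (b c : Fin m → ℝ) (j : Fin (2 ^ m)) :
    ∑ i, symbolProb c i * symbolProb (signedBits b i) j =
      symbolProb (shiftBits b fun k => 2 * c k - 1) j := by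
  simp only [symbolProb, signedBits, ← Finset.prod_mul_distrib]
  refine (sum_prod_nbcBit fun k u =>
    bitProb c k u * bitProb (shiftBits b fun _ => antipodal u) k (nbcBit j k)).trans
    (Finset.prod_congr rfl fun k _ => ?_)
  cases nbcBit j k <;> simp [bitProb, shiftBits, antipodal] <;> ring

theorem mean_newTransform {b : Fin m → ℝ} (hb : ∀ k, b k ∈ Set.Icc 0 1) (c : Fin m → ℝ)
    (X : Fin (2 ^ m) → EuclideanSpace ℝ (Fin N)) :
    mean c (newTransform b X) = mean (shiftBits b fun k => 2 * c k - 1) X := by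
  rw [mean]
  simp only [newTransform_eq_mean_signedBits hb, mean, Finset.smul_sum, smul_smul]
  rw [Finset.sum_comm]
  simp only [← Finset.sum_smul, sum_symbolProb_mul_symbolProb_signedBits]

theorem mean_uniformBits_newTransform {b : Fin m → ℝ} (hb : ∀ k, b k ∈ Set.Icc 0 1)
    (X : Fin (2 ^ m) → EuclideanSpace ℝ (Fin N)) :
    mean (uniformBits m) (newTransform b X) = mean b X := by
  have hshift : (shiftBits b fun k => 2 * uniformBits m k - 1) = b := by
    funext k
    simp [shiftBits, uniformBits]
  rw [mean_newTransform hb, hshift]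

theorem shiftBits_fixBit_uniformBits (b : Fin m → ℝ) (k : Fin m) (u : Bool) :
    (shiftBits b fun l => 2 * fixBit (uniformBits m) k u l - 1) =
      Function.update b k (b k + antipodal u * √(b k * (1 - b k))) := by
  funext l
  rcases eq_or_ne l k with rfl | hl
  · cases u <;> simp [shiftBits, fixBit, antipodal]; norm_num
  · simp [shiftBits, fixBit, uniformBits, hl]

theorem bitContrast_newTransform {b : Fin m → ℝ} (hb : ∀ k, b k ∈ Set.Icc 0 1)
    (X : Fin (2 ^ m) → EuclideanSpace ℝ (Fin N)) (k : Fin m) :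
    bitContrast (uniformBits m) (newTransform b X) k = bitContrast b X k := by
  have hσ : √(uniformBits m k * (1 - uniformBits m k)) = 1 / 2 := by
    rw [Real.sqrt_eq_iff_mul_self_eq] <;> norm_num [uniformBits]
  rw [bitContrast, hσ, mean_newTransform hb, mean_newTransform hb, shiftBits_fixBit_uniformBits,
    shiftBits_fixBit_uniformBits, mean_update, mean_update, bitContrast]
  simp only [antipodal, if_true, Bool.false_eq_true, if_false]
  module

theorem sum_uniformBits_mul_signedBits_mul {b : Fin m → ℝ} (hb : ∀ k, b k ∈ Set.Icc 0 1)
    (j l : Fin (2 ^ m)) :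
    ∑ i, symbolProb (uniformBits m) i *
        (symbolProb (signedBits b i) j * symbolProb (signedBits b i) l) =
      if j = l then symbolProb b j else 0 := by
  have hbit : ∀ k v v', ∑ u, bitProb (uniformBits m) k u *
      (bitProb (shiftBits b fun _ => antipodal u) k v *
        bitProb (shiftBits b fun _ => antipodal u) k v') = if v = v' then bitProb b k v else 0 := by
    intro k v v'
    have hσ := Real.mul_self_sqrt (mul_nonneg (hb k).1 (sub_nonneg.2 (hb k).2))
    simp only [bitProb, shiftBits, antipodal, uniformBits, Fintype.sum_bool]
    cases v <;> cases v' <;>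
      simp only [if_true, Bool.false_eq_true, Bool.true_eq_false, if_false] <;>
      first | linear_combination hσ | linear_combination -hσ
  have hprod : ∑ i, symbolProb (uniformBits m) i *
        (symbolProb (signedBits b i) j * symbolProb (signedBits b i) l) =
      ∏ k, if nbcBit j k = nbcBit l k then bitProb b k (nbcBit j k) else 0 := by
    simp only [symbolProb, signedBits, ← Finset.prod_mul_distrib, ← hbit]
    exact sum_prod_nbcBit fun k u => bitProb (uniformBits m) k u *
      (bitProb (shiftBits b fun _ => antipodal u) k (nbcBit j k) *
        bitProb (shiftBits b fun _ => antipodal u) k (nbcBit l k))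
  rw [hprod]
  split_ifs with hjl
  · simp only [hjl, if_true, symbolProb]
  · obtain ⟨k, hk⟩ := Function.ne_iff.1 ((nbcBit_injective m).ne hjl)
    exact Finset.prod_eq_zero (Finset.mem_univ k) (if_neg hk)

theorem sum_mul_norm_sum_smul_sq {ι κ V : Type*} [Fintype ι] [Fintype κ] [DecidableEq κ]
    [NormedAddCommGroup V] [InnerProductSpace ℝ V] {w : ι → ℝ} {p : κ → ℝ} {T : ι → κ → ℝ}
    (hT : ∀ j l, ∑ i, w i * (T i j * T i l) = if j = l then p j else 0) (x : κ → V) :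
    ∑ i, w i * ‖∑ j, T i j • x j‖ ^ 2 = ∑ j, p j * ‖x j‖ ^ 2 := by
  have hexpand : ∀ i, w i * ‖∑ j, T i j • x j‖ ^ 2 =
      ∑ j, ∑ l, w i * (T i j * T i l) * inner ℝ (x j) (x l) := by
    intro i
    rw [← real_inner_self_eq_norm_sq, sum_inner, Finset.mul_sum]
    refine Finset.sum_congr rfl fun j _ => ?_
    rw [inner_sum, Finset.mul_sum]
    refine Finset.sum_congr rfl fun l _ => ?_
    rw [inner_smul_left, inner_smul_right, conj_trivial]
    ring
  rw [Finset.sum_congr rfl fun i _ => hexpand i, Finset.sum_comm]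
  refine Finset.sum_congr rfl fun j _ => ?_
  rw [Finset.sum_comm]
  simp only [← Finset.sum_mul, hT, ite_mul, zero_mul, Finset.sum_ite_eq, Finset.mem_univ, if_true,
    real_inner_self_eq_norm_sq]

theorem energy_newTransform {b : Fin m → ℝ} (hb : ∀ k, b k ∈ Set.Icc 0 1)
    (X : Fin (2 ^ m) → EuclideanSpace ℝ (Fin N)) :
    energy (uniformBits m) (newTransform b X) = energy b X := by
  simp only [energy, newTransform_eq_mean_signedBits hb, mean]
  exact sum_mul_norm_sum_smul_sq (sum_uniformBits_mul_signedBits_mul hb) X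

end Transform

theorem hasDerivWithinAt_comp_sqrt_div {f : ℝ → ℝ} {L c : ℝ} (hf0 : f 0 = 0)
    (hf : Tendsto (fun ε => f ε / ε ^ 2) (𝓝[≠] 0) (𝓝 L)) (hc : 0 < c) :
    HasDerivWithinAt (fun s => f √(s / c)) (L / c) (Set.Ici 0) 0 := by
  have hsqrt : Tendsto (fun s => √(s / c)) (𝓝[>] 0) (𝓝[≠] 0) := by
    refine tendsto_nhdsWithin_iff.2 ⟨?_, ?_⟩
    · exact (Continuous.tendsto' (by fun_prop) 0 0 (by simp)).mono_left nhdsWithin_le_nhds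
    · filter_upwards [self_mem_nhdsWithin] with s (hs : 0 < s)
      exact (Real.sqrt_pos.2 (div_pos hs hc)).ne'
  rw [hasDerivWithinAt_iff_tendsto_slope, Set.Ici_sdiff_left]
  refine ((hf.comp hsqrt).div_const c).congr' ?_
  filter_upwards [self_mem_nhdsWithin] with s (hs : 0 < s)
  rw [slope_def_field, zero_div, Real.sqrt_zero, hf0, sub_zero, sub_zero, Function.comp_apply,
    Real.sq_sqrt (div_pos hs hc).le, div_div, div_mul_cancel₀ s hc.ne']

section Channel

variable {m N : ℕ}

theorem channelDensity_eq_gaussDensity (N₀ : ℝ) (h x : EuclideanSpace ℝ (Fin N)) :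
    channelDensity N₀ h x = gaussDensity N₀ (hadamardProd h x) := by
  funext y
  rw [channelDensity, gaussDensity, finrank_euclideanSpace, Fintype.card_fin]

theorem outputDensity_eq_gaussMixture (N₀ : ℝ) (b : Fin m → ℝ)
    (X : Fin (2 ^ m) → EuclideanSpace ℝ (Fin N)) (h : EuclideanSpace ℝ (Fin N)) :
    outputDensity N₀ b X h = gaussMixture N₀ (symbolProb b) fun i => hadamardProd h (X i) := by
  funext y
  simp only [outputDensity, gaussMixture, channelDensity_eq_gaussDensity]

theorem condOutputDensity_eq_outputDensity_fixBit {b : Fin m → ℝ} {k : Fin m} {u : Bool}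
    (hu : bitProb b k u ≠ 0) (N₀ : ℝ) (X : Fin (2 ^ m) → EuclideanSpace ℝ (Fin N)) :
    condOutputDensity N₀ b X k u = outputDensity N₀ (fixBit b k u) X := by
  funext h y
  rw [condOutputDensity, condSymbolProb_eq_symbolProb_fixBit hu, outputDensity]

theorem outputDensity_eq_sum_fixBit (N₀ : ℝ) (b : Fin m → ℝ)
    (X : Fin (2 ^ m) → EuclideanSpace ℝ (Fin N)) (k : Fin m) (h y : EuclideanSpace ℝ (Fin N)) :
    outputDensity N₀ b X h y = ∑ u, bitProb b k u * outputDensity N₀ (fixBit b k u) X h y := by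
  simp only [outputDensity, Finset.mul_sum, ← mul_assoc]
  rw [Finset.sum_comm]
  simp only [← Finset.sum_mul, ← symbolProb_eq_sum_fixBit]

theorem hadamardProd_smul (h x : EuclideanSpace ℝ (Fin N)) (t : ℝ) :
    hadamardProd h (t • x) = t • hadamardProd h x := by
  ext n
  simp only [hadamardProd, PiLp.smul_apply, smul_eq_mul]
  ring

theorem hadamardProd_sum {ι : Type*} (h : EuclideanSpace ℝ (Fin N)) (s : Finset ι)
    (x : ι → EuclideanSpace ℝ (Fin N)) :
    hadamardProd h (∑ i ∈ s, x i) = ∑ i ∈ s, hadamardProd h (x i) := by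
  ext n
  simp [hadamardProd, Finset.mul_sum]

theorem sum_symbolProb_smul_hadamardProd (b : Fin m → ℝ)
    (X : Fin (2 ^ m) → EuclideanSpace ℝ (Fin N)) (h : EuclideanSpace ℝ (Fin N)) :
    ∑ i, symbolProb b i • hadamardProd h (X i) = hadamardProd h (mean b X) := by
  simp only [mean, hadamardProd_sum, hadamardProd_smul]

theorem measurable_hadamardProd (X : Fin (2 ^ m) → EuclideanSpace ℝ (Fin N)) :
    Measurable fun (h : EuclideanSpace ℝ (Fin N)) i => hadamardProd h (X i) := by
  unfold hadamardProd
  fun_prop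

theorem norm_hadamardProd_sq (h x : EuclideanSpace ℝ (Fin N)) :
    ‖hadamardProd h x‖ ^ 2 = ∑ n, h n ^ 2 * x n ^ 2 := by
  simp only [EuclideanSpace.norm_sq_eq, hadamardProd, norm_mul, mul_pow, Real.norm_eq_abs, sq_abs]

variable {ν : Measure (EuclideanSpace ℝ (Fin N))}

theorem integrable_norm_hadamardProd_sq (hν : ∀ n, Integrable (fun h => h n ^ 2) ν)
    (x : EuclideanSpace ℝ (Fin N)) : Integrable (fun h => ‖hadamardProd h x‖ ^ 2) ν := by
  simp only [norm_hadamardProd_sq]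
  exact integrable_finsetSum _ fun n _ => (hν n).mul_const _

theorem integral_norm_hadamardProd_sq (hν : ∀ n, Integrable (fun h => h n ^ 2) ν) {q : ℝ}
    (hq : ∀ n, ∫ h, h n ^ 2 ∂ν = q) (x : EuclideanSpace ℝ (Fin N)) :
    ∫ h, ‖hadamardProd h x‖ ^ 2 ∂ν = q * ‖x‖ ^ 2 := by
  simp only [norm_hadamardProd_sq]
  rw [integral_finsetSum _ fun n _ => (hν n).mul_const _]
  simp only [integral_mul_const, hq, ← Finset.mul_sum, EuclideanSpace.norm_sq_eq, Real.norm_eq_abs,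
    sq_abs]

/-- The conditional Kullback–Leibler divergence, in nats, of the channel output given the fading
from the pure noise, averaged over the law `ν` of the fading vector. -/
noncomputable def fadingDivergence (ν : Measure (EuclideanSpace ℝ (Fin N))) (N₀ : ℝ)
    (b : Fin m → ℝ) (X : Fin (2 ^ m) → EuclideanSpace ℝ (Fin N)) : ℝ :=
  ∫ h, noiseDivergence N₀ (symbolProb b) (fun i => hadamardProd h (X i)) ∂ν

variable {N₀ : ℝ} {b : Fin m → ℝ}

theorem fadingDivergence_zero (hN₀ : 0 < N₀) (hb : ∀ k, b k ∈ Set.Icc 0 1) :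
    fadingDivergence ν N₀ b 0 = 0 := by
  have hzero : ∀ h : EuclideanSpace ℝ (Fin N), (fun _ : Fin (2 ^ m) => hadamardProd h 0) = 0 := by
    intro h
    funext i
    simpa using hadamardProd_smul h 0 0
  simp only [fadingDivergence, Pi.zero_apply, hzero,
    noiseDivergence_zero hN₀ (symbolProb_mem_stdSimplex hb), integral_zero]

theorem tendsto_fadingDivergence_smul_div_sq (hν : ∀ n, Integrable (fun h => h n ^ 2) ν) {q : ℝ}
    (hq : ∀ n, ∫ h, h n ^ 2 ∂ν = q) (hN₀ : 0 < N₀) (hb : ∀ k, b k ∈ Set.Icc 0 1)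
    (X : Fin (2 ^ m) → EuclideanSpace ℝ (Fin N)) :
    Tendsto (fun ε : ℝ => fadingDivergence ν N₀ b (ε • X) / ε ^ 2) (𝓝[≠] 0)
      (𝓝 (q * ‖mean b X‖ ^ 2 / N₀)) := by
  have hlim := tendsto_integral_noiseDivergence_smul_div_sq hN₀ (symbolProb_mem_stdSimplex hb)
    (measurable_hadamardProd X) fun i => integrable_norm_hadamardProd_sq hν (X i)
  simp only [sum_symbolProb_smul_hadamardProd, integral_norm_hadamardProd_sq hν hq] at hlim
  simp only [fadingDivergence, Pi.smul_apply, hadamardProd_smul]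
  exact hlim

theorem sum_mul_integral_mul_log_outputDensity (hN₀ : 0 < N₀) (hb : ∀ k, b k ∈ Set.Icc 0 1)
    (X : Fin (2 ^ m) → EuclideanSpace ℝ (Fin N)) (k : Fin m) (h : EuclideanSpace ℝ (Fin N)) :
    ∑ u, bitProb b k u * ∫ y, outputDensity N₀ (fixBit b k u) X h y *
        Real.log (outputDensity N₀ (fixBit b k u) X h y / outputDensity N₀ b X h y) =
      ∑ u, bitProb b k u * noiseDivergence N₀ (symbolProb (fixBit b k u))
          (fun i => hadamardProd h (X i)) -
        noiseDivergence N₀ (symbolProb b) fun i => hadamardProd h (X i) := by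
  have hfix := fun u => symbolProb_mem_stdSimplex (fixBit_mem_Icc hb k u)
  have hmix := outputDensity_eq_sum_fixBit N₀ b X k h
  have hpos := gaussMixture_pos hN₀ (symbolProb_mem_stdSimplex hb) fun i => hadamardProd h (X i)
  simp only [outputDensity_eq_gaussMixture] at hmix ⊢
  simp only [noiseDivergence, hmix] at hpos ⊢
  exact sum_mul_integral_mul_log_div (bitProb_mem_stdSimplex (hb k))
    (fun u => measurable_gaussMixture _ _ _) (fun u y => (gaussMixture_pos hN₀ (hfix u) _ y).le)
    (fun u => integrable_gaussMixture hN₀ _ _) (fun u => integral_gaussMixture hN₀ (hfix u).2 _)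
    hpos (measurable_gaussDensity N₀ 0) (gaussDensity_pos hN₀ 0)
    fun u => integrable_klDensity_gaussMixture hN₀ (hfix u) _

theorem bitMutualInfo_eq_fadingDivergence_sub (hν : ∀ n, Integrable (fun h => h n ^ 2) ν)
    (hN₀ : 0 < N₀) (hb : ∀ k, b k ∈ Set.Ioo 0 1) (X : Fin (2 ^ m) → EuclideanSpace ℝ (Fin N))
    (k : Fin m) :
    bitMutualInfo ν N₀ b X k =
      (∑ u, bitProb b k u * fadingDivergence ν N₀ (fixBit b k u) X - fadingDivergence ν N₀ b X) /
        Real.log 2 := by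
  have hbIcc := fun k => Set.Ioo_subset_Icc_self (hb k)
  have hint : ∀ c : Fin m → ℝ, (∀ k, c k ∈ Set.Icc 0 1) → Integrable
      (fun h => noiseDivergence N₀ (symbolProb c) fun i => hadamardProd h (X i)) ν := fun c hc =>
    integrable_noiseDivergence hN₀ (symbolProb_mem_stdSimplex hc) (measurable_hadamardProd X)
      fun i => integrable_norm_hadamardProd_sq hν (X i)
  have hintfix := fun u => (hint _ (fixBit_mem_Icc hbIcc k u)).const_mul (bitProb b k u)
  simp only [bitMutualInfo, condOutputDensity_eq_outputDensity_fixBit (bitProb_pos (hb k) _).ne',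
    Real.logb, ← mul_div_assoc, integral_div, ← Finset.sum_div,
    sum_mul_integral_mul_log_outputDensity hN₀ hbIcc]
  rw [integral_sub (integrable_finsetSum _ fun u _ => hintfix u) (hint b hbIcc),
    integral_finsetSum _ fun u _ => hintfix u]
  simp only [integral_const_mul, fadingDivergence]

theorem gmi_zero (hν : ∀ n, Integrable (fun h => h n ^ 2) ν) (hN₀ : 0 < N₀)
    (hb : ∀ k, b k ∈ Set.Ioo 0 1) : gmi ν N₀ b 0 = 0 := by
  have hbIcc := fun k => Set.Ioo_subset_Icc_self (hb k)
  refine Finset.sum_eq_zero fun k _ => ?_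
  simp [bitMutualInfo_eq_fadingDivergence_sub hν hN₀ hb, fadingDivergence_zero hN₀ hbIcc,
    fadingDivergence_zero hN₀ (fixBit_mem_Icc hbIcc k _)]

theorem tendsto_bitMutualInfo_smul_div_sq (hν : ∀ n, Integrable (fun h => h n ^ 2) ν) {q : ℝ}
    (hq : ∀ n, ∫ h, h n ^ 2 ∂ν = q) (hN₀ : 0 < N₀) (hb : ∀ k, b k ∈ Set.Ioo 0 1)
    (X : Fin (2 ^ m) → EuclideanSpace ℝ (Fin N)) (k : Fin m) :
    Tendsto (fun ε : ℝ => bitMutualInfo ν N₀ b (ε • X) k / ε ^ 2) (𝓝[≠] 0)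
      (𝓝 (q / (N₀ * Real.log 2) * ‖bitContrast b X k‖ ^ 2)) := by
  have hbIcc := fun k => Set.Ioo_subset_Icc_self (hb k)
  have hlim := ((tendsto_finsetSum Finset.univ fun u _ =>
    (tendsto_fadingDivergence_smul_div_sq hν hq hN₀ (fixBit_mem_Icc hbIcc k u) X).const_mul
      (bitProb b k u)).sub
    (tendsto_fadingDivergence_smul_div_sq hν hq hN₀ hbIcc X)).div_const (Real.log 2)
  rw [← sum_bitProb_mul_norm_mean_fixBit_sq_sub (hbIcc k)]
  convert hlim using 2 with ε
  · rw [bitMutualInfo_eq_fadingDivergence_sub hν hN₀ hb]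
    simp only [← mul_div_assoc, ← Finset.sum_div, ← sub_div, div_right_comm]
  · simp only [Fintype.sum_bool]
    ring

theorem tendsto_gmi_smul_div_sq (hν : ∀ n, Integrable (fun h => h n ^ 2) ν) {q : ℝ}
    (hq : ∀ n, ∫ h, h n ^ 2 ∂ν = q) (hN₀ : 0 < N₀) (hb : ∀ k, b k ∈ Set.Ioo 0 1)
    (X : Fin (2 ^ m) → EuclideanSpace ℝ (Fin N)) :
    Tendsto (fun ε : ℝ => gmi ν N₀ b (ε • X) / ε ^ 2) (𝓝[≠] 0)
      (𝓝 (q / (N₀ * Real.log 2) * ∑ k, ‖bitContrast b X k‖ ^ 2)) := by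
  simp only [gmi, Finset.sum_div, Finset.mul_sum]
  exact tendsto_finsetSum _ fun k _ => tendsto_bitMutualInfo_smul_div_sq hν hq hN₀ hb X k

theorem energy_nonneg (hb : ∀ k, b k ∈ Set.Icc 0 1) (X : Fin (2 ^ m) → EuclideanSpace ℝ (Fin N)) :
    0 ≤ energy b X :=
  Finset.sum_nonneg fun i _ => mul_nonneg ((symbolProb_mem_stdSimplex hb).1 i) (sq_nonneg _)

theorem hasDerivWithinAt_gmiAtSNR {ρ : Measure ℝ} (hpos : 0 < secondMoment ρ)
    (hν : ∀ n, Integrable (fun h => h n ^ 2) ν) (hmoment : ∀ n, ∫ h, h n ^ 2 ∂ν = secondMoment ρ)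
    (hN₀ : 0 < N₀) (hb : ∀ k, b k ∈ Set.Ioo 0 1) (X : Fin (2 ^ m) → EuclideanSpace ℝ (Fin N)) :
    HasDerivWithinAt (gmiAtSNR ν ρ N₀ b X)
      ((∑ k, ‖bitContrast b X k‖ ^ 2) / (energy b X * Real.log 2)) (Set.Ici 0) 0 := by
  rcases (energy_nonneg (fun k => Set.Ioo_subset_Icc_self (hb k)) X).eq_or_lt with hE | hE
  · -- The zero alphabet: `gmiAtSNR` is constant and the claimed slope is `x / 0 = 0`.
    have hconst : gmiAtSNR ν ρ N₀ b X = fun _ => gmi ν N₀ b fun _ => 0 := by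
      funext s
      simp [gmiAtSNR, snr, ← hE]
    rw [hconst, ← hE, zero_mul, div_zero]
    exact hasDerivWithinAt_const _ _ _
  · have hsnr : 0 < snr ρ N₀ b X := div_pos (mul_pos hpos hE) hN₀
    have hzero : gmi ν N₀ b ((0 : ℝ) • X) = 0 := by rw [zero_smul, gmi_zero hν hN₀ hb]
    refine (hasDerivWithinAt_comp_sqrt_div hzero
      (tendsto_gmi_smul_div_sq hν hmoment hN₀ hb X) hsnr).congr_deriv ?_
    rw [snr]
    field_simp

theorem uniformBits_mem_Ioo (k : Fin m) : uniformBits m k ∈ Set.Ioo 0 1 := by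
  norm_num [uniformBits]

end Channel

end BICM

theorem theorem6_general {m N : ℕ}
    (b : Fin m → ℝ) (hb : ∀ k, 0 < b k ∧ b k < 1)
    (X : Fin (2 ^ m) → EuclideanSpace ℝ (Fin N))
    (ν : Measure (EuclideanSpace ℝ (Fin N))) (hν : ∀ n, Integrable (fun h => h n ^ 2) ν)
    (ρ : Measure ℝ) (hmoment : ∀ n, ∫ h, h n ^ 2 ∂ν = BICM.secondMoment ρ)
    (hpos : 0 < BICM.secondMoment ρ) (N₀ : ℝ) (hN₀ : 0 < N₀) :
    DifferentiableWithinAt ℝ (BICM.gmiAtSNR ν ρ N₀ b X) (Set.Ici 0) 0 ∧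
    DifferentiableWithinAt ℝ
      (BICM.gmiAtSNR ν ρ N₀ (BICM.uniformBits m) (BICM.newTransform b X)) (Set.Ici 0) 0 ∧
    BICM.lowGMIParameters ν ρ N₀ b X =
      BICM.lowGMIParameters ν ρ N₀ (BICM.uniformBits m) (BICM.newTransform b X) := by
  have hbIcc := fun k => Set.Ioo_subset_Icc_self (hb k)
  have hunique : UniqueDiffWithinAt ℝ (Set.Ici (0 : ℝ)) 0 := uniqueDiffOn_Ici 0 0 Set.self_mem_Ici
  have hderiv := BICM.hasDerivWithinAt_gmiAtSNR hpos hν hmoment hN₀ hb X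
  have hderivU := BICM.hasDerivWithinAt_gmiAtSNR hpos hν hmoment hN₀ BICM.uniformBits_mem_Ioo
    (BICM.newTransform b X)
  refine ⟨hderiv.differentiableWithinAt, hderivU.differentiableWithinAt, ?_⟩
  simp only [BICM.lowGMIParameters, BICM.alpha, hderiv.derivWithin hunique,
    hderivU.derivWithin hunique, BICM.mean_uniformBits_newTransform hbIcc,
    BICM.energy_newTransform hbIcc, BICM.bitContrast_newTransform hbIcc]

theorem theorem6 {m N : ℕ}
    (b : Fin m → ℝ) (hb : ∀ k, 0 < b k ∧ b k < 1)
    (X : Fin (2 ^ m) → EuclideanSpace ℝ (Fin N))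
    (ν : Measure (EuclideanSpace ℝ (Fin N))) [IsProbabilityMeasure ν]
    (ρ : Measure ℝ) [IsProbabilityMeasure ρ]
    (hmarginal : ∀ n : Fin N, ν.map (fun h => h n) = ρ)
    (hint : Integrable (fun t : ℝ => t ^ 2) ρ) (hpos : 0 < BICM.secondMoment ρ)
    (N₀ : ℝ) (hN₀ : 0 < N₀) :
    DifferentiableWithinAt ℝ (BICM.gmiAtSNR ν ρ N₀ b X) (Set.Ici 0) 0 ∧
    DifferentiableWithinAt ℝ
      (BICM.gmiAtSNR ν ρ N₀ (BICM.uniformBits m) (BICM.newTransform b X)) (Set.Ici 0) 0 ∧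
    BICM.lowGMIParameters ν ρ N₀ b X =
      BICM.lowGMIParameters ν ρ N₀ (BICM.uniformBits m) (BICM.newTransform b X) := by
  have hcoord : ∀ n, MeasurePreserving (fun h : EuclideanSpace ℝ (Fin N) => h n) ν ρ :=
    fun n => ⟨by fun_prop, hmarginal n⟩
  refine theorem6_general b hb X ν (fun n => (hcoord n).integrable_comp_of_integrable hint) ρ
    (fun n => ?_) hpos N₀ hN₀
  rw [BICM.secondMoment, ← hmarginal n, integral_map (by fun_prop) (by fun_prop)]
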